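/- Let $L$ be a countable one-sorted continuous signature in which the metric and all predicates take values in $[0,1]$ (every symbol comes with a modulus of uniform continuity), let $T$ be an $L$-theory (a set of closed conditions $\theta=0$ with $\theta$ a finitary $L$-sentence), let $C$ be a countably infinite set of new constant symbols, and let $L(C)=L\cup C$. Restricted $L(C)_{\omega_1,\omega}$-formulas are built from atomic formulas by $\neg\varphi=1-\varphi$, $\frac12\varphi$, truncated addition $\varphi\dotplus\psi=\min(\varphi+\psi,1)$, the quantifier $\inf_x$, and countable disjunctions $\bigvee_m\varphi_m$, interpreted as $\inf_m\varphi_m$; the latter are formed only for nonempty countable families $(\varphi_m)$ with free variables in a common finite set and with a common modulus of uniform continuity. A condition is a finite set $p$ of expressions $\varphi<r$, with $\varphi$ a restricted finitary quantifier-free $L(C)$-sentence and $r\in\mathbb R$, such that $T\cup p$ is satisfiable. Game forcing. Players $\forall$ and $\exists$ alternately play conditions $p_0\subseteq p_1\subseteq p_2\subseteq\cdots$, with $\forall$ moving first. Put $\bar p=\bigcup_n p_n$. The play is definitive if for every atomic $L(C)$-sentence $\varphi$ there is a unique $r\in[0,1]$ with $T\cup\bar p\models\varphi=r$; in that case these values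 make the set of closed $L(C)$-terms an $L(C)$-prestructure, and $A^+(\bar p)$ denotes its completion. For a property $P$ of $L(C)$-structures, $\exists$ wins $G(P)$ if the play is definitive and $A^+(\bar p)$ has property $P$. A condition $p$ forces $P$ if every position $(p_0,\dots,p_k)$ with $p\subseteq p_k$ is winning for $\exists$ in $G(P)$. For a sentence $\varphi$ put $$F^g_p(\varphi)=\inf\{r>0 : p\text{ forces the property }\varphi<r\}.$$ Weak forcing. For a condition $p$ and a restricted $L(C)_{\omega_1,\omega}$-sentence $\varphi$ define $F_p(\varphi)\in[0,1]$ by recursion on $\varphi$: $F_p(\varphi)=\min\{r\le 1 : (\varphi<r)\in p\}$ for atomic $\varphi$ (with $\min\emptyset=1$); $F_p(\neg\varphi)=1-\inf_{q\supseteq p}F_q(\varphi)$; $F_p(\frac12\varphi)=\frac12F_p(\varphi)$; $F_p(\varphi\dotplus\psi)=F_p(\varphi)\dotplus F_p(\psi)$; $F_p(\bigvee_m\varphi_m)=\inf_mF_p(\varphi_m)$; $F_p(\inf_x\varphi(x))=\inf_{c\in C}F_p(\varphi(c))$. Here $q$, and $q'$ below, range over conditions. Put $$F^w_p(\varphi)=\sup_{q\supseteq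 p}\ \inf_{q'\supseteq q}F_{q'}(\varphi).$$ Theorem. For every condition $p$ and every restricted $L(C)_{\omega_1,\omega}$-sentence $\varphi$, $F^g_p(\varphi)=F^w_p(\varphi)$. -/

import Mathlib

open scoped unitInterval

noncomputable section

namespace ContGame

/-! ### Continuous signatures, terms and formulas -/

/-- A one-sorted continuous signature.  Every symbol has an arity and a modulus of uniform
continuity; the metric is a logical symbol and predicates take values in `[0,1]`. -/
structure Signature where
  Func : Type
  Rel : Type
  funcArity : Func → ℕ
  relArity : Rel → ℕ
  funcMod : Func → ℝ → ℝ
  relMod : Rel → ℝ → ℝ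
  funcMod_pos : ∀ f ε, 0 < ε → 0 < funcMod f ε
  relMod_pos : ∀ R ε, 0 < ε → 0 < relMod R ε

/-- The signature `L(C)`: the elements of `C` are added to `L` as new constant symbols. -/
def Signature.withConsts (L : Signature) (C : Type) : Signature where
  Func := L.Func ⊕ C
  Rel := L.Rel
  funcArity := Sum.elim L.funcArity fun _ => 0
  relArity := L.relArity
  funcMod := Sum.elim L.funcMod fun _ _ => 1
  relMod := L.relMod
  funcMod_pos := by
    rintro (f | c) ε hε
    · exact L.funcMod_pos f ε hε
    · exact one_pos
  relMod_pos := L.relMod_pos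

/-- Terms with free variables among `x_0, …, x_{n-1}`; `Term S 0` is the set of closed terms. -/
inductive Term (S : Signature) (n : ℕ) : Type
  | var (i : Fin n) : Term S n
  | func (f : S.Func) (ts : Fin (S.funcArity f) → Term S n) : Term S n

/-- Atomic formulas: predicate symbols, and the metric, applied to terms. -/
inductive Atomic (S : Signature) (n : ℕ) : Type
  | rel (R : S.Rel) (ts : Fin (S.relArity R) → Term S n) : Atomic S n
  | dist (t s : Term S n) : Atomic S n

/-- Finitary formulas of continuous logic, with all continuous connectives `[0,1]^k → [0,1]`.
The quantifiers bind the last variable. -/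
inductive Formula (S : Signature) : ℕ → Type
  | atom {n : ℕ} (a : Atomic S n) : Formula S n
  | conn {n k : ℕ} (u : C(Fin k → I, I)) (φ : Fin k → Formula S n) : Formula S n
  | sup {n : ℕ} (φ : Formula S (n + 1)) : Formula S n
  | inf {n : ℕ} (φ : Formula S (n + 1)) : Formula S n

/-- Raw restricted infinitary formulas: `¬`, `1/2`, truncated addition, countable `⋁` (interpreted
as an infimum, since `0` is the value "true") and the quantifier `inf`, which binds the last
variable.  The restricted formulas of `L_{ω₁,ω}` are those that satisfy `RFormula.WF` below. -/
inductive RFormula (S : Signature) : ℕ → Type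
  | atom {n : ℕ} (a : Atomic S n) : RFormula S n
  | neg {n : ℕ} (φ : RFormula S n) : RFormula S n
  | half {n : ℕ} (φ : RFormula S n) : RFormula S n
  | plus {n : ℕ} (φ ψ : RFormula S n) : RFormula S n
  | bigvee {n : ℕ} (φ : ℕ → RFormula S n) : RFormula S n
  | inf {n : ℕ} (φ : RFormula S (n + 1)) : RFormula S n

/-- The finitary quantifier-free formulas among the restricted ones. -/
def RFormula.IsQF {S : Signature} : {n : ℕ} → RFormula S n → Prop
  | _, .atom _ => True
  | _, .neg φ => φ.IsQF
  | _, .half φ => φ.IsQF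
  | _, .plus φ ψ => φ.IsQF ∧ ψ.IsQF
  | _, .bigvee _ => False
  | _, .inf _ => False

/-! ### Structures -/

/-- A prestructure: a pseudometric space of diameter at most `1` with interpretations of the
symbols that respect the moduli of uniform continuity (tuples carry the maximum metric). -/
structure Prestructure (S : Signature) where
  carrier : Type
  [pseudoMetric : PseudoMetricSpace carrier]
  dist_le_one : ∀ x y : carrier, dist x y ≤ 1
  func : (f : S.Func) → (Fin (S.funcArity f) → carrier) → carrier
  rel : (R : S.Rel) → (Fin (S.relArity R) → carrier) → I
  func_mod : ∀ (f : S.Func) (ε : ℝ), 0 < ε → ∀ v w : Fin (S.funcArity f) → carrier,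
    dist v w < S.funcMod f ε → dist (func f v) (func f w) ≤ ε
  rel_mod : ∀ (R : S.Rel) (ε : ℝ), 0 < ε → ∀ v w : Fin (S.relArity R) → carrier,
    dist v w < S.relMod R ε → dist (rel R v) (rel R w) ≤ ε

attribute [instance] Prestructure.pseudoMetric

/-- A structure: a prestructure whose pseudometric is a complete metric. -/
structure Structure (S : Signature) extends Prestructure S where
  t0 : T0Space carrier
  complete : CompleteSpace carrier

/-- The value of a term under an assignment. -/
def Term.eval {S : Signature} (M : Prestructure S) {n : ℕ} (v : Fin n → M.carrier) :
    Term S n → M.carrier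
  | .var i => v i
  | .func f ts => M.func f fun i => (ts i).eval M v

/-- The value of an atomic formula under an assignment. -/
def Atomic.eval {S : Signature} (M : Prestructure S) {n : ℕ} (v : Fin n → M.carrier) :
    Atomic S n → I
  | .rel R ts => M.rel R fun i => (ts i).eval M v
  | .dist t s => ⟨Dist.dist (t.eval M v) (s.eval M v), dist_nonneg, M.dist_le_one _ _⟩

/-- The value of a finitary formula; suprema and infima are those of the complete lattice
`[0,1]`. -/
def Formula.eval {S : Signature} (M : Prestructure S) :
    {n : ℕ} → Formula S n → (Fin n → M.carrier) → I
  | _, .atom a, v => a.eval M v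
  | _, .conn u φ, v => u fun i => (φ i).eval M v
  | _, .sup φ, v => ⨆ x : M.carrier, φ.eval M (Fin.snoc v x)
  | _, .inf φ, v => ⨅ x : M.carrier, φ.eval M (Fin.snoc v x)

/-- `x ↦ x / 2` on `[0,1]`. -/
def halfI (x : I) : I := ⟨(x : ℝ) / 2, by have := x.2.1; positivity, by linarith [x.2.2]⟩

/-- Truncated addition `min (x + y) 1` on `[0,1]`. -/
def plusI (x y : I) : I :=
  ⟨min ((x : ℝ) + y) 1, le_min (add_nonneg x.2.1 y.2.1) zero_le_one, min_le_right _ _⟩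

/-- The value of a restricted infinitary formula; `σ x = 1 - x`. -/
def RFormula.eval {S : Signature} (M : Prestructure S) :
    {n : ℕ} → RFormula S n → (Fin n → M.carrier) → I
  | _, .atom a, v => a.eval M v
  | _, .neg φ, v => σ (φ.eval M v)
  | _, .half φ, v => halfI (φ.eval M v)
  | _, .plus φ ψ, v => plusI (φ.eval M v) (ψ.eval M v)
  | _, .bigvee φ, v => ⨅ m : ℕ, (φ m).eval M v
  | _, .inf φ, v => ⨅ x : M.carrier, φ.eval M (Fin.snoc v x)

/-- The formation rule of `L_{ω₁,ω}`: `⋁_m φ_m` is a formula only if the `φ_m` are formulas with a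
common modulus of uniform continuity, valid in all structures. -/
def RFormula.WF {S : Signature} : {n : ℕ} → RFormula S n → Prop
  | _, .atom _ => True
  | _, .neg φ => φ.WF
  | _, .half φ => φ.WF
  | _, .plus φ ψ => φ.WF ∧ ψ.WF
  | n, .bigvee φ => (∀ m, (φ m).WF) ∧
      ∀ ε : ℝ, 0 < ε → ∃ δ : ℝ, 0 < δ ∧ ∀ (m : ℕ) (M : Structure S) (v w : Fin n → M.carrier),
        dist v w < δ →
          dist ((φ m).eval M.toPrestructure v) ((φ m).eval M.toPrestructure w) ≤ ε
  | _, .inf φ => φ.WF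

/-- The reduct to `L` of an `L(C)`-structure. -/
def Structure.reduct {L : Signature} {C : Type} (M : Structure (L.withConsts C)) :
    Structure L where
  carrier := M.carrier
  dist_le_one := M.dist_le_one
  func f := M.func (Sum.inl f)
  rel R := M.rel R
  func_mod f := M.func_mod (Sum.inl f)
  rel_mod R := M.rel_mod R
  t0 := M.t0
  complete := M.complete

/-! ### Completion of a prestructure -/

namespace Prestructure

variable {S : Signature} (M : Prestructure S)

theorem uniformContinuous_func (f : S.Func) : UniformContinuous (M.func f) := by
  rw [Metric.uniformContinuous_iff]
  intro ε hε
  exact ⟨S.funcMod f (ε / 2), S.funcMod_pos f _ (half_pos hε), fun v w h =>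
    (M.func_mod f _ (half_pos hε) v w h).trans_lt (half_lt_self hε)⟩

theorem uniformContinuous_rel (R : S.Rel) : UniformContinuous (M.rel R) := by
  rw [Metric.uniformContinuous_iff]
  intro ε hε
  exact ⟨S.relMod R (ε / 2), S.relMod_pos R _ (half_pos hε), fun v w h =>
    (M.rel_mod R _ (half_pos hε) v w h).trans_lt (half_lt_self hε)⟩

/-- The coordinatewise canonical map of `M^n` into `(completion of M)^n`. -/
def coeTuple (n : ℕ) (v : Fin n → M.carrier) : Fin n → UniformSpace.Completion M.carrier :=
  fun i => (v i : UniformSpace.Completion M.carrier)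

theorem isometry_coeTuple (n : ℕ) : Isometry (M.coeTuple n) :=
  Isometry.piMap (fun _ : Fin n => ((↑) : M.carrier → UniformSpace.Completion M.carrier))
    fun _ => UniformSpace.Completion.coe_isometry

theorem denseRange_coeTuple (n : ℕ) : DenseRange (M.coeTuple n) :=
  DenseRange.piMap (f := fun _ : Fin n =>
    ((↑) : M.carrier → UniformSpace.Completion M.carrier))
    fun _ => UniformSpace.Completion.denseRange_coe

theorem isDenseInducing_coeTuple (n : ℕ) : IsDenseInducing (M.coeTuple n) :=
  (M.isometry_coeTuple n).isUniformInducing.isDenseInducing (M.denseRange_coeTuple n)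

theorem extend_mod {n : ℕ} {Y : Type} [MetricSpace Y] [CompleteSpace Y]
    {g : (Fin n → M.carrier) → Y} (hg : UniformContinuous g) {δ ε : ℝ}
    (h : ∀ v w, dist v w < δ → dist (g v) (g w) ≤ ε)
    (v w : Fin n → UniformSpace.Completion M.carrier) (hvw : dist v w < δ) :
    dist ((M.isDenseInducing_coeTuple n).extend g v)
      ((M.isDenseInducing_coeTuple n).extend g w) ≤ ε := by
  have hc : Continuous ((M.isDenseInducing_coeTuple n).extend g) :=
    (uniformContinuous_uniformly_extend (M.isometry_coeTuple n).isUniformInducing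
      (M.denseRange_coeTuple n) hg).continuous
  let U : Set ((Fin n → UniformSpace.Completion M.carrier) ×
    (Fin n → UniformSpace.Completion M.carrier)) := {q | dist q.1 q.2 < δ}
  let K : Set ((Fin n → UniformSpace.Completion M.carrier) ×
    (Fin n → UniformSpace.Completion M.carrier)) :=
    {q | dist ((M.isDenseInducing_coeTuple n).extend g q.1)
      ((M.isDenseInducing_coeTuple n).extend g q.2) ≤ ε}
  have hU : IsOpen U := isOpen_lt (by fun_prop) continuous_const
  have hK : IsClosed K := isClosed_le
    ((hc.comp continuous_fst).dist (hc.comp continuous_snd)) continuous_const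
  have hd : Dense (Set.range (Prod.map (M.coeTuple n) (M.coeTuple n))) :=
    (M.denseRange_coeTuple n).prodMap (M.denseRange_coeTuple n)
  have hsub : U ∩ Set.range (Prod.map (M.coeTuple n) (M.coeTuple n)) ⊆ K := by
    rintro _ ⟨hq, ⟨a, b⟩, rfl⟩
    have h1 : dist a b < δ := by
      rw [← (M.isometry_coeTuple n).dist_eq]; exact hq
    change dist ((M.isDenseInducing_coeTuple n).extend g (M.coeTuple n a))
      ((M.isDenseInducing_coeTuple n).extend g (M.coeTuple n b)) ≤ ε
    rw [(M.isDenseInducing_coeTuple n).extend_eq hg.continuous,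
      (M.isDenseInducing_coeTuple n).extend_eq hg.continuous]
    exact h a b h1
  exact closure_minimal hsub hK (hd.open_subset_closure_inter hU (a := (v, w)) hvw)

/-- The completion of a prestructure: the (Hausdorff) completion of the pseudometric space, with
the unique continuous extensions of the interpretations of the symbols. -/
def completion : Structure S where
  carrier := UniformSpace.Completion M.carrier
  dist_le_one x y := by
    induction x, y using UniformSpace.Completion.induction_on₂ with
    | hp => exact isClosed_le (by fun_prop) continuous_const
    | ih a b => rw [UniformSpace.Completion.dist_eq]; exact M.dist_le_one a b
  func f := (M.isDenseInducing_coeTuple _).extend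
    fun v => (M.func f v : UniformSpace.Completion M.carrier)
  rel R := (M.isDenseInducing_coeTuple _).extend (M.rel R)
  func_mod f ε hε v w h := M.extend_mod
    ((UniformSpace.Completion.uniformContinuous_coe _).comp (M.uniformContinuous_func f))
    (fun a b hab => by
      rw [Function.comp_apply, Function.comp_apply, UniformSpace.Completion.dist_eq]
      exact M.func_mod f ε hε a b hab) v w h
  rel_mod R ε hε v w h := M.extend_mod (M.uniformContinuous_rel R) (M.rel_mod R ε hε) v w h
  t0 := inferInstance
  complete := inferInstance

end Prestructure

/-! ### Conditions -/

section Forcing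

variable {L : Signature} {C : Type}

/-- A strict inequality `φ < r`, as the pair `(φ, r)`. -/
abbrev Ineq (L : Signature) (C : Type) : Type := RFormula (L.withConsts C) 0 × ℝ

/-- `M ⊨ T ∪ Γ`: the reduct of `M` to `L` is a model of the theory `T` (a set of `L`-sentences `θ`,
standing for the closed conditions `θ = 0`), and `M` satisfies all inequalities in `Γ`. -/
def Models (T : Set (Formula L 0)) (Γ : Set (Ineq L C)) (M : Structure (L.withConsts C)) : Prop :=
  (∀ θ ∈ T, θ.eval M.reduct.toPrestructure Fin.elim0 = 0) ∧
    ∀ e ∈ Γ, (e.1.eval M.toPrestructure Fin.elim0 : ℝ) < e.2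

/-- A condition: a finite set of inequalities `φ < r` between restricted quantifier-free
`L(C)`-sentences and real numbers, satisfiable together with `T`. -/
structure Condition (C : Type) (T : Set (Formula L 0)) where
  ineqs : Set (Ineq L C)
  finite : ineqs.Finite
  isQF : ∀ e ∈ ineqs, e.1.IsQF
  satisfiable : ∃ M : Structure (L.withConsts C), Models T ineqs M

/-- Conditions are ordered by inclusion: `p ≤ q` means `p ⊆ q`. -/
instance (T : Set (Formula L 0)) : Preorder (Condition C T) :=
  Preorder.lift Condition.ineqs

/-! ### The compiled structure -/

/-- `Γ` is definitive: every atomic `L(C)`-sentence `a` has a unique `r ∈ [0,1]` with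
`T ∪ Γ ⊨ a = r`. -/
def Definitive (T : Set (Formula L 0)) (Γ : Set (Ineq L C)) : Prop :=
  ∀ a : Atomic (L.withConsts C) 0, ∃! r : I,
    ∀ M : Structure (L.withConsts C), Models T Γ M → a.eval M.toPrestructure Fin.elim0 = r

namespace Definitive

variable {T : Set (Formula L 0)} {Γ : Set (Ineq L C)} (h : Definitive T Γ)

/-- The value of an atomic sentence that is determined by a definitive set. -/
def value (a : Atomic (L.withConsts C) 0) : I := (h a).choose

theorem value_eq (a : Atomic (L.withConsts C) 0) {M : Structure (L.withConsts C)}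
    (hM : Models T Γ M) : h.value a = a.eval M.toPrestructure Fin.elim0 :=
  ((h a).choose_spec.1 M hM).symm

theorem exists_model (h : Definitive T Γ) (a : Atomic (L.withConsts C) 0) :
    ∃ M : Structure (L.withConsts C), Models T Γ M := by
  by_contra hne
  push Not at hne
  obtain ⟨r, -, hr⟩ := h a
  have h0 := hr 0 fun M hM => absurd hM (hne M)
  have h1 := hr 1 fun M hM => absurd hM (hne M)
  exact zero_ne_one (h0.trans h1.symm)

theorem value_dist {M : Structure (L.withConsts C)} (hM : Models T Γ M)
    (t s : Term (L.withConsts C) 0) :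
    (h.value (.dist t s) : ℝ) =
      dist (t.eval M.toPrestructure Fin.elim0) (s.eval M.toPrestructure Fin.elim0) := by
  rw [h.value_eq _ hM]; rfl

/-- The pseudometric on closed terms described by a definitive set. -/
abbrev termPseudoMetric : PseudoMetricSpace (Term (L.withConsts C) 0) where
  dist t s := h.value (.dist t s)
  dist_self t := by
    obtain ⟨M, hM⟩ := h.exists_model (.dist t t)
    rw [h.value_dist hM, dist_self]
  dist_comm t s := by
    obtain ⟨M, hM⟩ := h.exists_model (.dist t t)
    rw [h.value_dist hM, h.value_dist hM, dist_comm]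
  dist_triangle t s u := by
    obtain ⟨M, hM⟩ := h.exists_model (.dist t t)
    rw [h.value_dist hM, h.value_dist hM, h.value_dist hM]
    exact dist_triangle _ _ _

theorem tuple_dist {M : Structure (L.withConsts C)} (hM : Models T Γ M) {n : ℕ}
    (v w : Fin n → Term (L.withConsts C) 0) :
    letI := h.termPseudoMetric
    dist v w = dist (fun i => (v i).eval M.toPrestructure Fin.elim0)
      (fun i => (w i).eval M.toPrestructure Fin.elim0) := by
  let := h.termPseudoMetric
  have : Isometry fun t : Term (L.withConsts C) 0 => t.eval M.toPrestructure Fin.elim0 :=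
    Isometry.of_dist_eq fun t s => (h.value_dist hM t s).symm
  exact ((Isometry.piMap (fun _ : Fin n => fun t : Term (L.withConsts C) 0 =>
    t.eval M.toPrestructure Fin.elim0) fun _ => this).dist_eq v w).symm

/-- The prestructure of closed `L(C)`-terms described by a definitive set. -/
def termPrestructure : Prestructure (L.withConsts C) :=
  letI := h.termPseudoMetric
  { carrier := Term (L.withConsts C) 0
    dist_le_one := fun t s => (h.value (.dist t s)).2.2
    func := fun f ts => .func f ts
    rel := fun R ts => h.value (.rel R ts)
    func_mod := fun f ε hε v w hvw => by
      obtain ⟨M, hM⟩ := h.exists_model (.dist (.func f v) (.func f v))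
      rw [h.tuple_dist hM] at hvw
      exact (h.value_dist hM _ _).trans_le (M.func_mod f ε hε _ _ hvw)
    rel_mod := fun R ε hε v w hvw => by
      obtain ⟨M, hM⟩ := h.exists_model (.rel R v)
      rw [h.tuple_dist hM] at hvw
      rw [h.value_eq _ hM, h.value_eq _ hM]
      exact M.rel_mod R ε hε _ _ hvw }

/-- The compiled structure: the completion of the prestructure of closed terms. -/
def compiled : Structure (L.withConsts C) := h.termPrestructure.completion

end Definitive

/-! ### The game and game forcing -/

/-- A strategy for player `∃`: given the moves `p_0, …, p_n` made so far, it returns a legal next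
move `p_{n+1} ⊇ p_n`. -/
structure Strategy (C : Type) (T : Set (Formula L 0)) where
  move : (n : ℕ) → (Fin (n + 1) → Condition C T) → Condition C T
  legal : ∀ n h, h (Fin.last n) ≤ move n h

variable {T : Set (Formula L 0)}

/-- Player `∃` wins the play `p_0 ⊆ p_1 ⊆ ⋯` of `G(P)`: the union of the play is definitive and the
compiled structure has property `P`. -/
def Wins (P : Structure (L.withConsts C) → Prop) (s : ℕ → Condition C T) : Prop :=
  ∃ h : Definitive T (⋃ n, (s n).ineqs), P h.compiled

/-- The position `(p_0, …, p_k)` is winning for `∃` in `G(P)`: some strategy wins every play that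
starts with `p_0, …, p_k` and in which `∃`, who makes the moves with odd index, follows the strategy
from then on. -/
def WinningPosition (P : Structure (L.withConsts C) → Prop) (k : ℕ)
    (pos : Fin (k + 1) → Condition C T) : Prop :=
  ∃ τ : Strategy C T, ∀ s : ℕ → Condition C T, Monotone s →
    (∀ i : Fin (k + 1), s i = pos i) →
    (∀ n, k ≤ n → Odd (n + 1) → s (n + 1) = τ.move n fun i : Fin (n + 1) => s i) →
    Wins P s

/-- `p` forces `P`: every position `(p_0, …, p_k)` with `p ⊆ p_k` is winning for `∃` in `G(P)`. -/
def Forces (p : Condition C T) (P : Structure (L.withConsts C) → Prop) : Prop :=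
  ∀ (k : ℕ) (pos : Fin (k + 1) → Condition C T), Monotone pos → p ≤ pos (Fin.last k) →
    WinningPosition P k pos

/-- The game-forcing value `F^g_p(φ)`. -/
def gameValue (p : Condition C T) (φ : RFormula (L.withConsts C) 0) : ℝ :=
  sInf {r : ℝ | 0 < r ∧ Forces p fun A => (φ.eval A.toPrestructure Fin.elim0 : ℝ) < r}

/-! ### Weak forcing -/

/-- A constant from `C` as a term. -/
def constTerm (L : Signature) {C : Type} (c : C) : Term (L.withConsts C) 0 :=
  .func (S := L.withConsts C) (Sum.inr c) Fin.elim0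

/-- Substitution of constants from `C` for the variables of a term. -/
def Term.subst {n : ℕ} (v : Fin n → C) : Term (L.withConsts C) n → Term (L.withConsts C) 0
  | .var i => constTerm L (v i)
  | .func f ts => .func f fun i => (ts i).subst v

/-- Substitution of constants from `C` for the variables of an atomic formula. -/
def Atomic.subst {n : ℕ} (v : Fin n → C) : Atomic (L.withConsts C) n → Atomic (L.withConsts C) 0
  | .rel R ts => .rel (S := L.withConsts C) R fun i => (ts i).subst v
  | .dist t s => .dist (t.subst v) (s.subst v)

/-- `f_p(a)`: the least `r ≤ 1` such that `a < r` belongs to `p`, and `1` if there is none (the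
infimum is taken in `[0,1]`; no `r < 0` occurs, as `p` is satisfiable). -/
def atomValue (p : Condition C T) (a : Atomic (L.withConsts C) 0) : I :=
  sInf {r : I | (RFormula.atom a, (r : ℝ)) ∈ p.ineqs}

/-- The strong forcing value `F_p(φ(v))`, where `φ(v)` is the sentence obtained from `φ` by
substituting the constants `v` for the variables. -/
def strongValue : {n : ℕ} → RFormula (L.withConsts C) n → Condition C T → (Fin n → C) → I
  | _, .atom a, p, v => atomValue p (a.subst v)
  | _, .neg φ, p, v => σ (⨅ q : {q : Condition C T // p ≤ q}, strongValue φ q.1 v)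
  | _, .half φ, p, v => halfI (strongValue φ p v)
  | _, .plus φ ψ, p, v => plusI (strongValue φ p v) (strongValue ψ p v)
  | _, .bigvee φ, p, v => ⨅ m : ℕ, strongValue (φ m) p v
  | _, .inf φ, p, v => ⨅ c : C, strongValue φ p (Fin.snoc v c)

/-- The weak forcing value `F^w_p(φ)`. -/
def weakValue (p : Condition C T) (φ : RFormula (L.withConsts C) 0) : I :=
  ⨆ q : {q : Condition C T // p ≤ q}, ⨅ q' : {q' : Condition C T // q.1 ≤ q'},
    strongValue φ q'.1 Fin.elim0

end Forcing

end ContGame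

end

noncomputable section

namespace ContGame

open Filter Topology

/-! ### Infima and suprema in the unit interval -/

theorem exists_lt_iInf_add {ι : Type*} [Nonempty ι] (f : ι → I) {ε : ℝ} (hε : 0 < ε) :
    ∃ i, (f i : ℝ) < (⨅ i, f i : I) + ε := by
  by_contra! hcon
  obtain ⟨i₀⟩ := ‹Nonempty ι›
  have h0 := (⨅ i, f i : I).2.1
  have hle : (⟨(⨅ i, f i : I) + ε, by linarith, (hcon i₀).trans (f i₀).2.2⟩ : I) ≤ ⨅ i, f i :=
    le_iInf fun i => hcon i
  have h1 : ((⨅ i, f i : I) : ℝ) + ε ≤ (⨅ i, f i : I) := hle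
  linarith

theorem exists_iSup_sub_lt {ι : Type*} [Nonempty ι] (f : ι → I) {ε : ℝ} (hε : 0 < ε) :
    ∃ i, ((⨆ i, f i : I) : ℝ) - ε < f i := by
  by_contra! hcon
  obtain ⟨i₀⟩ := ‹Nonempty ι›
  have h0 := (⨆ i, f i : I).2.2
  have hle : (⨆ i, f i) ≤ (⟨(⨆ i, f i : I) - ε, (f i₀).2.1.trans (hcon i₀), by linarith⟩ : I) :=
    iSup_le fun i => hcon i
  have h1 : ((⨆ i, f i : I) : ℝ) ≤ (⨆ i, f i : I) - ε := hle
  linarith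

theorem iInf_le_iInf_add {ι : Type*} {f g : ι → I} {ε : ℝ} (hε : 0 ≤ ε)
    (h : ∀ i, (f i : ℝ) ≤ g i + ε) : ((⨅ i, f i : I) : ℝ) ≤ (⨅ i, g i : I) + ε := by
  rcases isEmpty_or_nonempty ι with hι | hι
  · simp only [iInf_of_empty]; linarith
  · refine le_of_forall_pos_le_add fun η hη => ?_
    obtain ⟨i, hi⟩ := exists_lt_iInf_add g hη
    have h1 : ((⨅ i, f i : I) : ℝ) ≤ f i := iInf_le f i
    linarith [h i]

theorem iSup_le_iSup_add {ι : Type*} {f g : ι → I} {ε : ℝ} (hε : 0 ≤ ε)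
    (h : ∀ i, (f i : ℝ) ≤ g i + ε) : ((⨆ i, f i : I) : ℝ) ≤ (⨆ i, g i : I) + ε := by
  rcases isEmpty_or_nonempty ι with hι | hι
  · simp only [iSup_of_empty]; linarith
  · refine le_of_forall_pos_le_add fun η hη => ?_
    obtain ⟨i, hi⟩ := exists_iSup_sub_lt f hη
    have h1 : (g i : ℝ) ≤ (⨆ i, g i : I) := le_iSup g i
    linarith [h i]

theorem le_add_of_dist_le {x y : I} {ε : ℝ} (h : dist x y ≤ ε) : (x : ℝ) ≤ y + ε := by
  rw [Subtype.dist_eq, Real.dist_eq] at h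
  linarith [(abs_le.1 h).2]

theorem dist_le_of_le_add {x y : I} {ε : ℝ} (h : (x : ℝ) ≤ y + ε) (h' : (y : ℝ) ≤ x + ε) :
    dist x y ≤ ε := by
  rw [Subtype.dist_eq, Real.dist_eq, abs_le]
  constructor <;> linarith

theorem dist_iInf_le {ι : Type*} {f g : ι → I} {ε : ℝ} (hε : 0 ≤ ε)
    (h : ∀ i, dist (f i) (g i) ≤ ε) : dist (⨅ i, f i) (⨅ i, g i) ≤ ε :=
  dist_le_of_le_add (iInf_le_iInf_add hε fun i => le_add_of_dist_le (h i))
    (iInf_le_iInf_add hε fun i => le_add_of_dist_le (dist_comm (f i) (g i) ▸ h i))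

theorem dist_iSup_le {ι : Type*} {f g : ι → I} {ε : ℝ} (hε : 0 ≤ ε)
    (h : ∀ i, dist (f i) (g i) ≤ ε) : dist (⨆ i, f i) (⨆ i, g i) ≤ ε :=
  dist_le_of_le_add (iSup_le_iSup_add hε fun i => le_add_of_dist_le (h i))
    (iSup_le_iSup_add hε fun i => le_add_of_dist_le (dist_comm (f i) (g i) ▸ h i))

theorem continuous_halfI : Continuous halfI :=
  Continuous.subtype_mk (by fun_prop) _

theorem continuous_plusI : Continuous fun x : I × I => plusI x.1 x.2 :=
  Continuous.subtype_mk (by fun_prop) _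

theorem uniformContinuous_iInf {ι X : Type*} [PseudoMetricSpace X] {f : ι → X → I}
    (h : ∀ ε > 0, ∃ δ > 0, ∀ i x y, dist x y < δ → dist (f i x) (f i y) ≤ ε) :
    UniformContinuous fun x => ⨅ i, f i x := by
  rw [Metric.uniformContinuous_iff]
  intro ε hε
  obtain ⟨δ, hδ, H⟩ := h (ε / 2) (half_pos hε)
  exact ⟨δ, hδ, fun {x y} hxy =>
    (dist_iInf_le (half_pos hε).le fun i => H i x y hxy).trans_lt (half_lt_self hε)⟩

theorem uniformContinuous_iSup {ι X : Type*} [PseudoMetricSpace X] {f : ι → X → I}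
    (h : ∀ ε > 0, ∃ δ > 0, ∀ i x y, dist x y < δ → dist (f i x) (f i y) ≤ ε) :
    UniformContinuous fun x => ⨆ i, f i x := by
  rw [Metric.uniformContinuous_iff]
  intro ε hε
  obtain ⟨δ, hδ, H⟩ := h (ε / 2) (half_pos hε)
  exact ⟨δ, hδ, fun {x y} hxy =>
    (dist_iSup_le (half_pos hε).le fun i => H i x y hxy).trans_lt (half_lt_self hε)⟩

/-- The infimum of a continuous function is its infimum over the range of a dense map. -/
theorem _root_.DenseRange.iInf_comp_eq {ι X : Type*} [TopologicalSpace X] {g : ι → X}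
    (hg : DenseRange g) {f : X → I} (hf : Continuous f) : ⨅ x, f x = ⨅ i, f (g i) := by
  refine le_antisymm (le_iInf fun i => iInf_le f (g i)) (le_iInf fun x => ?_)
  exact hg.induction_on x (isClosed_le continuous_const hf) fun i => iInf_le (fun i => f (g i)) i

theorem _root_.DenseRange.iSup_comp_eq {ι X : Type*} [TopologicalSpace X] {g : ι → X}
    (hg : DenseRange g) {f : X → I} (hf : Continuous f) : ⨆ x, f x = ⨆ i, f (g i) := by
  refine le_antisymm (iSup_le fun x => ?_) (iSup_le fun i => le_iSup f (g i))
  exact hg.induction_on x (isClosed_le hf continuous_const) fun i => le_iSup (fun i => f (g i)) i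

/-! ### Uniform continuity of the evaluation maps -/

section UniformContinuity

variable {S : Signature} (M : Prestructure S)

theorem dist_snoc_lt {X : Type*} [PseudoMetricSpace X] {n : ℕ} {v w : Fin n → X} {δ : ℝ}
    (hδ : 0 < δ) (h : dist v w < δ) (x : X) :
    dist (Fin.snoc v x : Fin (n + 1) → X) (Fin.snoc w x) < δ := by
  rw [dist_pi_lt_iff hδ] at h ⊢
  intro i
  refine Fin.lastCases ?_ (fun j => ?_) i
  · simpa using hδ
  · simpa using h j

theorem continuous_snoc {X : Type*} [TopologicalSpace X] {n : ℕ} (v : Fin n → X) :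
    Continuous fun x => (Fin.snoc v x : Fin (n + 1) → X) := by
  refine continuous_pi fun i => ?_
  refine Fin.lastCases ?_ (fun j => ?_) i
  · simpa using continuous_id'
  · simpa using continuous_const

theorem Term.uniformContinuous_eval {n : ℕ} (t : Term S n) :
    UniformContinuous fun v => t.eval M v := by
  induction t with
  | var i => exact Pi.uniformContinuous_proj _ i
  | func f ts ih => exact (M.uniformContinuous_func f).comp (uniformContinuous_pi.2 ih)

theorem Atomic.uniformContinuous_eval {n : ℕ} (a : Atomic S n) :
    UniformContinuous fun v => a.eval M v := by
  cases a with
  | rel R ts =>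
    exact (M.uniformContinuous_rel R).comp
      (uniformContinuous_pi.2 fun i => (ts i).uniformContinuous_eval M)
  | dist t s =>
    exact ((t.uniformContinuous_eval M).dist (s.uniformContinuous_eval M)).subtype_mk _

theorem uniformContinuous_snoc_modulus {n : ℕ} {f : (Fin (n + 1) → M.carrier) → I}
    (hf : UniformContinuous f) : ∀ ε > 0, ∃ δ > 0, ∀ (x : M.carrier) (v w : Fin n → M.carrier),
      dist v w < δ → dist (f (Fin.snoc v x)) (f (Fin.snoc w x)) ≤ ε := by
  intro ε hε
  obtain ⟨δ, hδ, H⟩ := Metric.uniformContinuous_iff.1 hf ε hε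
  exact ⟨δ, hδ, fun x v w h => (H (dist_snoc_lt hδ h x)).le⟩

theorem Formula.uniformContinuous_eval {n : ℕ} (φ : Formula S n) :
    UniformContinuous fun v => φ.eval M v := by
  induction φ with
  | atom a => exact a.uniformContinuous_eval M
  | conn u φ ih =>
    exact (CompactSpace.uniformContinuous_of_continuous u.continuous).comp
      (uniformContinuous_pi.2 ih)
  | sup φ ih => exact uniformContinuous_iSup (uniformContinuous_snoc_modulus M ih)
  | inf φ ih => exact uniformContinuous_iInf (uniformContinuous_snoc_modulus M ih)

theorem RFormula.WF.uniformContinuous_eval (M : Structure S) {n : ℕ} {φ : RFormula S n}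
    (h : φ.WF) : UniformContinuous fun v => φ.eval M.toPrestructure v := by
  induction φ with
  | atom a => exact a.uniformContinuous_eval M.toPrestructure
  | neg φ ih =>
    exact (CompactSpace.uniformContinuous_of_continuous unitInterval.continuous_symm).comp (ih h)
  | half φ ih =>
    exact (CompactSpace.uniformContinuous_of_continuous continuous_halfI).comp (ih h)
  | plus φ ψ ihφ ihψ =>
    exact (CompactSpace.uniformContinuous_of_continuous continuous_plusI).comp
      ((ihφ h.1).prodMk (ihψ h.2))
  | bigvee φ ih =>
    refine uniformContinuous_iInf fun ε hε => ?_
    obtain ⟨δ, hδ, H⟩ := h.2 ε hε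
    exact ⟨δ, hδ, fun m => H m M⟩
  | inf φ ih => exact uniformContinuous_iInf (uniformContinuous_snoc_modulus _ (ih h))

end UniformContinuity

/-! ### Evaluation in the completion -/

section Completion

variable {S : Signature} (M : Prestructure S)

theorem Term.eval_completion {n : ℕ} (t : Term S n) (v : Fin n → M.carrier) :
    t.eval M.completion.toPrestructure (M.coeTuple n v) =
      (t.eval M v : UniformSpace.Completion M.carrier) := by
  induction t with
  | var i => rfl
  | func f ts ih =>
    have h1 : (fun i => (ts i).eval M.completion.toPrestructure (M.coeTuple n v)) =
        M.coeTuple _ fun i => (ts i).eval M v := funext ih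
    change (M.isDenseInducing_coeTuple _).extend _
      (fun i => (ts i).eval M.completion.toPrestructure (M.coeTuple n v)) = _
    rw [h1]
    exact (M.isDenseInducing_coeTuple _).extend_eq
      ((UniformSpace.Completion.continuous_coe _).comp (M.uniformContinuous_func f).continuous) _

theorem Atomic.eval_completion {n : ℕ} (a : Atomic S n) (v : Fin n → M.carrier) :
    a.eval M.completion.toPrestructure (M.coeTuple n v) = a.eval M v := by
  cases a with
  | rel R ts =>
    have h1 : (fun i => (ts i).eval M.completion.toPrestructure (M.coeTuple n v)) =
        M.coeTuple _ fun i => (ts i).eval M v := funext fun i => (ts i).eval_completion M v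
    change (M.isDenseInducing_coeTuple _).extend _
      (fun i => (ts i).eval M.completion.toPrestructure (M.coeTuple n v)) = _
    rw [h1]
    exact (M.isDenseInducing_coeTuple _).extend_eq (M.uniformContinuous_rel R).continuous _
  | dist t s =>
    apply Subtype.ext
    change Dist.dist (t.eval M.completion.toPrestructure _)
      (s.eval M.completion.toPrestructure _) = Dist.dist _ _
    rw [t.eval_completion, s.eval_completion]
    exact UniformSpace.Completion.dist_eq _ _

theorem coeTuple_snoc {n : ℕ} (v : Fin n → M.carrier) (x : M.carrier) :
    M.coeTuple (n + 1) (Fin.snoc v x) =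
      Fin.snoc (M.coeTuple n v) (x : UniformSpace.Completion M.carrier) :=
  Fin.comp_snoc (fun y : M.carrier => (y : UniformSpace.Completion M.carrier)) v x

theorem Formula.eval_completion {n : ℕ} (φ : Formula S n) (v : Fin n → M.carrier) :
    φ.eval M.completion.toPrestructure (M.coeTuple n v) = φ.eval M v := by
  induction φ with
  | atom a => exact a.eval_completion M v
  | conn u φ ih => exact congrArg u (funext fun i => ih i v)
  | sup φ ih =>
    refine (UniformSpace.Completion.denseRange_coe.iSup_comp_eq
      ((φ.uniformContinuous_eval M.completion.toPrestructure).continuous.comp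
        (continuous_snoc (M.coeTuple _ v)))).trans (iSup_congr fun x => ?_)
    rw [← ih, coeTuple_snoc]
    rfl
  | inf φ ih =>
    refine (UniformSpace.Completion.denseRange_coe.iInf_comp_eq
      ((φ.uniformContinuous_eval M.completion.toPrestructure).continuous.comp
        (continuous_snoc (M.coeTuple _ v)))).trans (iInf_congr fun x => ?_)
    rw [← ih, coeTuple_snoc]
    rfl

end Completion

/-! ### Ultraproducts -/

section Ultraproduct

variable {ι : Type} (U : Ultrafilter ι)

/-- The limit of a family in `[0,1]` along an ultrafilter. -/
def ulim (f : ι → I) : I := (U.map f).lim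

theorem tendsto_ulim (f : ι → I) : Tendsto f U (𝓝 (ulim U f)) := (U.map f).le_nhds_lim

variable {U}

theorem ulim_eq {f : ι → I} {x : I} (h : Tendsto f U (𝓝 x)) : ulim U f = x :=
  tendsto_nhds_unique (tendsto_ulim U f) h

theorem ulim_mono {f g : ι → I} (h : ∀ᶠ i in U, f i ≤ g i) : ulim U f ≤ ulim U g :=
  le_of_tendsto_of_tendsto (tendsto_ulim U f) (tendsto_ulim U g) h

theorem tendsto_coe_ulim (f : ι → I) : Tendsto (fun i => (f i : ℝ)) U (𝓝 (ulim U f : ℝ)) :=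
  (continuous_subtype_val.tendsto _).comp (tendsto_ulim U f)

theorem ulim_le {f : ι → I} {r : ℝ} (h : ∀ᶠ i in U, (f i : ℝ) ≤ r) : (ulim U f : ℝ) ≤ r :=
  le_of_tendsto (tendsto_coe_ulim f) h

theorem eventually_lt_of_ulim_lt {f : ι → I} {r : ℝ} (h : (ulim U f : ℝ) < r) :
    ∀ᶠ i in U, (f i : ℝ) < r :=
  (tendsto_coe_ulim f).eventually_lt_const h

variable {S : Signature} (U) (M : ι → Prestructure S)

/-- The distance of two points of a prestructure as an element of `[0,1]`. -/
def distI (N : Prestructure S) (x y : N.carrier) : I := ⟨dist x y, dist_nonneg, N.dist_le_one x y⟩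

/-- The pseudometric on the product of a family of prestructures given by an ultrafilter. -/
abbrev ultraPseudoMetric : PseudoMetricSpace (∀ i, (M i).carrier) where
  dist x y := ulim U fun i => distI (M i) (x i) (y i)
  dist_self x := by
    have : (fun i => distI (M i) (x i) (x i)) = fun _ => 0 :=
      funext fun i => Subtype.ext (dist_self (x i))
    rw [this, ulim_eq tendsto_const_nhds]
    rfl
  dist_comm x y := by
    have : (fun i => distI (M i) (x i) (y i)) = fun i => distI (M i) (y i) (x i) :=
      funext fun i => Subtype.ext (dist_comm (x i) (y i))
    rw [this]
  dist_triangle x y z :=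
    le_of_tendsto_of_tendsto (tendsto_coe_ulim _)
      ((tendsto_coe_ulim _).add (tendsto_coe_ulim _))
      (Eventually.of_forall fun i => dist_triangle (x i) (y i) (z i))

theorem eventually_dist_lt {n : ℕ} {δ : ℝ} (hδ : 0 < δ) (v w : Fin n → ∀ i, (M i).carrier)
    (h : letI := ultraPseudoMetric U M; dist v w < δ) :
    ∀ᶠ i in U, dist (fun j => v j i) (fun j => w j i) < δ := by
  let := ultraPseudoMetric U M
  rw [dist_pi_lt_iff hδ] at h
  have h1 : ∀ᶠ i in U, ∀ j, dist (v j i) (w j i) < δ :=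
    eventually_all.2 fun j => eventually_lt_of_ulim_lt (h j)
  exact h1.mono fun i hi => (dist_pi_lt_iff hδ).2 hi

/-- The ultraproduct of a family of prestructures, before identification and completion. -/
def ultraproduct : Prestructure S :=
  letI := ultraPseudoMetric U M
  { carrier := ∀ i, (M i).carrier
    dist_le_one := fun _ _ => (ulim U _).2.2
    func := fun f v i => (M i).func f fun j => v j i
    rel := fun R v => ulim U fun i => (M i).rel R fun j => v j i
    func_mod := fun f ε hε v w h =>
      ulim_le <| (eventually_dist_lt U M (S.funcMod_pos f ε hε) v w h).mono fun i hi =>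
        (M i).func_mod f ε hε _ _ hi
    rel_mod := fun R ε hε v w h =>
      le_of_tendsto ((tendsto_ulim U _).dist (tendsto_ulim U _)) <|
        (eventually_dist_lt U M (S.relMod_pos R ε hε) v w h).mono fun i hi =>
          (M i).rel_mod R ε hε _ _ hi }

theorem Term.eval_ultraproduct {n : ℕ} (t : Term S n) (v : Fin n → ∀ i, (M i).carrier) :
    t.eval (ultraproduct U M) v = fun i => t.eval (M i) fun j => v j i := by
  induction t with
  | var i => rfl
  | func f ts ih =>
    funext i
    exact congrArg ((M i).func f) (funext fun j => congrFun (ih j) i)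

theorem Atomic.eval_ultraproduct {n : ℕ} (a : Atomic S n) (v : Fin n → ∀ i, (M i).carrier) :
    a.eval (ultraproduct U M) v = ulim U fun i => a.eval (M i) fun j => v j i := by
  cases a with
  | rel R ts =>
    change (ulim U fun i => (M i).rel R fun j => (ts j).eval (ultraproduct U M) v i) = _
    simp only [Term.eval_ultraproduct]
    rfl
  | dist t s =>
    apply Subtype.ext
    change ((ulim U fun i => distI (M i) (t.eval (ultraproduct U M) v i)
      (s.eval (ultraproduct U M) v i) : I) : ℝ) = _
    simp only [Term.eval_ultraproduct]
    rfl

theorem snoc_apply_pi {n : ℕ} (v : Fin n → ∀ i, (M i).carrier) (x : ∀ i, (M i).carrier) (i : ι) :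
    (fun j => (Fin.snoc v x : Fin (n + 1) → ∀ i, (M i).carrier) j i) =
      Fin.snoc (fun j => v j i) (x i) :=
  Fin.comp_snoc (fun y : ∀ i, (M i).carrier => y i) v x

theorem ulim_iSup [∀ i, Nonempty (M i).carrier] (f : ∀ i, (M i).carrier → I) :
    (⨆ x : ∀ i, (M i).carrier, ulim U fun i => f i (x i)) = ulim U fun i => ⨆ y, f i y := by
  refine le_antisymm (iSup_le fun x => ulim_mono (Eventually.of_forall fun i => le_iSup (f i) _))
    ?_
  refine Subtype.coe_le_coe.1 (le_of_forall_pos_le_add fun ε hε => ?_)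
  choose x hx using fun i => exists_iSup_sub_lt (f i) hε
  have h1 : ((ulim U fun i => f i (x i) : I) : ℝ) ≤
      (⨆ x : ∀ i, (M i).carrier, ulim U fun i => f i (x i) : I) :=
    le_iSup (fun x : ∀ i, (M i).carrier => ulim U fun i => f i (x i)) x
  have h2 : ((ulim U fun i => ⨆ y, f i y : I) : ℝ) ≤ (ulim U fun i => f i (x i) : I) + ε :=
    le_of_tendsto_of_tendsto (tendsto_coe_ulim _) ((tendsto_coe_ulim _).add tendsto_const_nhds)
      (Eventually.of_forall fun i => by dsimp only; linarith [hx i])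
  linarith

theorem ulim_iInf [∀ i, Nonempty (M i).carrier] (f : ∀ i, (M i).carrier → I) :
    (⨅ x : ∀ i, (M i).carrier, ulim U fun i => f i (x i)) = ulim U fun i => ⨅ y, f i y := by
  refine le_antisymm ?_
    (le_iInf fun x => ulim_mono (Eventually.of_forall fun i => iInf_le (f i) _))
  refine Subtype.coe_le_coe.1 (le_of_forall_pos_le_add fun ε hε => ?_)
  choose x hx using fun i => exists_lt_iInf_add (f i) hε
  have h1 : ((⨅ x : ∀ i, (M i).carrier, ulim U fun i => f i (x i) : I) : ℝ) ≤
      (ulim U fun i => f i (x i) : I) :=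
    iInf_le (fun x : ∀ i, (M i).carrier => ulim U fun i => f i (x i)) x
  have h2 : ((ulim U fun i => f i (x i) : I) : ℝ) ≤ (ulim U fun i => ⨅ y, f i y : I) + ε :=
    le_of_tendsto_of_tendsto (tendsto_coe_ulim _) ((tendsto_coe_ulim _).add tendsto_const_nhds)
      (Eventually.of_forall fun i => (hx i).le)
  linarith

/-- Łoś's theorem for finitary formulas. -/
theorem Formula.eval_ultraproduct [∀ i, Nonempty (M i).carrier] {n : ℕ} (φ : Formula S n)
    (v : Fin n → ∀ i, (M i).carrier) :
    φ.eval (ultraproduct U M) v = ulim U fun i => φ.eval (M i) fun j => v j i := by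
  induction φ with
  | atom a => exact a.eval_ultraproduct U M v
  | conn u φ ih =>
    refine (congrArg u (funext fun k => ih k v)).trans (ulim_eq ?_).symm
    exact (u.continuous.tendsto _).comp (tendsto_pi_nhds.2 fun k => tendsto_ulim U _)
  | sup φ ih =>
    refine Eq.trans (iSup_congr fun x => ?_) (ulim_iSup U M _)
    refine (ih _).trans (congrArg (ulim U) (funext fun i => ?_))
    exact congrArg (φ.eval (M i)) (snoc_apply_pi M v x i)
  | inf φ ih =>
    refine Eq.trans (iInf_congr fun x => ?_) (ulim_iInf U M _)
    refine (ih _).trans (congrArg (ulim U) (funext fun i => ?_))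
    exact congrArg (φ.eval (M i)) (snoc_apply_pi M v x i)

/-- Łoś's theorem for restricted quantifier-free sentences, in the completed ultraproduct. -/
theorem RFormula.IsQF.eval_ultraproduct {n : ℕ} {φ : RFormula S n} (h : φ.IsQF)
    (v : Fin n → ∀ i, (M i).carrier) :
    φ.eval (ultraproduct U M).completion.toPrestructure ((ultraproduct U M).coeTuple n v) =
      ulim U fun i => φ.eval (M i) fun j => v j i := by
  induction φ with
  | atom a => exact (a.eval_completion (ultraproduct U M) v).trans (a.eval_ultraproduct U M v)
  | neg φ ih =>
    have ht := tendsto_ulim U fun i => φ.eval (M i) fun j => v j i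
    refine (congrArg σ (ih h v)).trans (Eq.symm ?_)
    exact ulim_eq ((unitInterval.continuous_symm.tendsto _).comp ht)
  | half φ ih =>
    have ht := tendsto_ulim U fun i => φ.eval (M i) fun j => v j i
    refine (congrArg halfI (ih h v)).trans (Eq.symm ?_)
    exact ulim_eq ((continuous_halfI.tendsto _).comp ht)
  | plus φ ψ ihφ ihψ =>
    have ht := tendsto_ulim U fun i => φ.eval (M i) fun j => v j i
    have ht' := tendsto_ulim U fun i => ψ.eval (M i) fun j => v j i
    refine (congrArg₂ plusI (ihφ h.1 v) (ihψ h.2 v)).trans (Eq.symm ?_)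
    exact ulim_eq ((continuous_plusI.tendsto (_, _)).comp (ht.prodMk_nhds ht'))
  | bigvee φ ih => exact h.elim
  | inf φ ih => exact h.elim

end Ultraproduct

/-- Compactness for increasing sequences of conditions: if every inequality of the sequence is
eventually improved, then the union is satisfiable together with the theory. -/
theorem exists_models_iUnion {L : Signature} {C : Type} [Nonempty C] {T : Set (Formula L 0)}
    {s : ℕ → Condition C T} (hs : Monotone s)
    (htight : ∀ n, ∀ e ∈ (s n).ineqs, ∃ r < e.2, ∃ m, (e.1, r) ∈ (s m).ineqs) :
    ∃ M : Structure (L.withConsts C), Models T (⋃ n, (s n).ineqs) M := by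
  choose N hN using fun n => (s n).satisfiable
  let U : Ultrafilter ℕ := hyperfilter ℕ
  let M : ℕ → Prestructure (L.withConsts C) := fun n => (N n).toPrestructure
  have hne : ∀ n, Nonempty (M n).carrier := fun n =>
    ⟨(M n).func (Sum.inr (Classical.arbitrary C)) Fin.elim0⟩
  refine ⟨(ultraproduct U M).completion, fun θ hθ => ?_, fun e he => ?_⟩
  · let R : ℕ → Prestructure L := fun n => (N n).reduct.toPrestructure
    have : ∀ n, Nonempty (R n).carrier := hne
    have h1 : θ.eval (ultraproduct U R).completion.toPrestructure
        ((ultraproduct U R).coeTuple 0 fun j => j.elim0) = 0 := by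
      refine (θ.eval_completion _ _).trans ((θ.eval_ultraproduct U R _).trans ?_)
      refine ulim_eq (tendsto_const_nhds.congr fun n => ?_)
      rw [← (hN n).1 θ hθ]
      exact congrArg _ (funext fun j => j.elim0)
    refine Eq.trans ?_ h1
    exact congrArg (θ.eval (ultraproduct U R).completion.toPrestructure)
      (funext fun j => j.elim0)
  · obtain ⟨n, hn⟩ := Set.mem_iUnion.1 he
    obtain ⟨r, hr, m, hm⟩ := htight n e hn
    refine lt_of_le_of_lt ?_ hr
    have h1 : (Fin.elim0 : Fin 0 → (ultraproduct U M).completion.carrier) =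
      (ultraproduct U M).coeTuple 0 fun j => j.elim0 := funext fun j => j.elim0
    rw [h1]
    refine (congrArg Subtype.val
      (RFormula.IsQF.eval_ultraproduct U M ((s n).isQF e hn) _)).trans_le (ulim_le ?_)
    have h2 : ∀ᶠ k in (U : Filter ℕ), m ≤ k :=
      (Nat.cofinite_eq_atTop ▸ hyperfilter_le_cofinite : (U : Filter ℕ) ≤ atTop)
        (eventually_ge_atTop m)
    refine h2.mono fun k hk => ?_
    have h3 := (hN k).2 _ (hs hk hm)
    exact (congrArg (fun w => (e.1.eval (M k) w : ℝ)) (funext fun j => j.elim0)).trans_le h3.le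

/-! ### Countability of terms and atomic formulas -/

section Countable

variable {S : Signature}

/-- Terms as elements of a `W`-type. -/
def Term.toWType {n : ℕ} :
    Term S n → WType (Sum.elim (fun _ => Fin 0) fun f => Fin (S.funcArity f) :
      Fin n ⊕ S.Func → Type)
  | .var i => ⟨Sum.inl i, Fin.elim0⟩
  | .func f ts => ⟨Sum.inr f, fun i => (ts i).toWType⟩

theorem Term.toWType_injective {n : ℕ} :
    Function.Injective (Term.toWType : Term S n → _) := by
  intro t
  induction t with
  | var i =>
    rintro (j | ⟨g, us⟩) h
    · exact congrArg Term.var (Sum.inl_injective (WType.mk.inj h).1)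
    · exact absurd (WType.mk.inj h).1 Sum.inl_ne_inr
  | func f ts ih =>
    rintro (j | ⟨g, us⟩) h
    · exact absurd (WType.mk.inj h).1 Sum.inr_ne_inl
    · obtain ⟨h1, h2⟩ := WType.mk.inj h
      obtain rfl := Sum.inr_injective h1
      congr 1
      funext i
      exact ih i (congrFun (eq_of_heq h2) i)

instance [Countable S.Func] (n : ℕ) : Countable (Term S n) := by
  have := Encodable.ofCountable S.Func
  have : ∀ a : Fin n ⊕ S.Func, Fintype ((Sum.elim (fun _ => Fin 0) fun f =>
      Fin (S.funcArity f) : Fin n ⊕ S.Func → Type) a) := by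
    rintro (i | f) <;> dsimp <;> infer_instance
  have : ∀ a : Fin n ⊕ S.Func, Encodable ((Sum.elim (fun _ => Fin 0) fun f =>
      Fin (S.funcArity f) : Fin n ⊕ S.Func → Type) a) := by
    rintro (i | f) <;> dsimp <;> infer_instance
  exact Term.toWType_injective.countable

instance [Countable S.Func] [Countable S.Rel] (n : ℕ) : Countable (Atomic S n) := by
  let g : Atomic S n → (Σ R : S.Rel, Fin (S.relArity R) → Term S n) ⊕ (Term S n × Term S n)
    | .rel R ts => Sum.inl ⟨R, ts⟩
    | .dist t s => Sum.inr (t, s)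
  refine Function.Injective.countable (f := g) ?_
  rintro (⟨R, ts⟩ | ⟨t, s⟩) (⟨R', ts'⟩ | ⟨t', s'⟩) h
  · obtain ⟨rfl, h2⟩ := Sigma.mk.inj_iff.1 (Sum.inl_injective h)
    rw [eq_of_heq h2]
  · cases h
  · cases h
  · obtain ⟨rfl, rfl⟩ := Prod.mk_inj.1 (Sum.inr_injective h)
    rfl

/-- The formulas whose negation is a subformula of a given formula. -/
def RFormula.negated : {n : ℕ} → RFormula S n → Set (Σ n, RFormula S n)
  | _, .atom _ => ∅
  | n, .neg φ => insert ⟨n, φ⟩ φ.negated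
  | _, .half φ => φ.negated
  | _, .plus φ ψ => φ.negated ∪ ψ.negated
  | _, .bigvee φ => ⋃ m, (φ m).negated
  | _, .inf φ => φ.negated

theorem RFormula.countable_negated {n : ℕ} (φ : RFormula S n) : φ.negated.Countable := by
  induction φ with
  | atom a => exact Set.countable_empty
  | neg φ ih => exact ih.insert _
  | half φ ih => exact ih
  | plus φ ψ ihφ ihψ => exact ihφ.union ihψ
  | bigvee φ ih => exact Set.countable_iUnion ih
  | inf φ ih => exact ih

end Countable

/-! ### Changing the interpretation of a constant -/

section SetConst

variable {L : Signature} {C : Type}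

open Classical in
/-- The structure `M` with the constant `c` reinterpreted as `a`. -/
def Structure.setConst (M : Structure (L.withConsts C)) (c : C) (a : M.carrier) :
    Structure (L.withConsts C) where
  carrier := M.carrier
  dist_le_one := M.dist_le_one
  func f := match f with
    | .inl f => M.func (Sum.inl f)
    | .inr c' => fun v => if c' = c then a else M.func (Sum.inr c') v
  rel := M.rel
  func_mod := by
    rintro (f | c') ε hε v w h
    · exact M.func_mod (Sum.inl f) ε hε v w h
    · have hvw : v = w := funext fun j : Fin 0 => j.elim0
      rw [hvw, dist_self]
      exact hε.le
  rel_mod := M.rel_mod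
  t0 := M.t0
  complete := M.complete

theorem Structure.eval_constTerm_setConst (M : Structure (L.withConsts C)) (c : C)
    (a : M.carrier) (v : Fin 0 → M.carrier) :
    (constTerm L c).eval (M.setConst c a).toPrestructure v = a :=
  if_pos rfl

theorem Term.exists_finite_eval_setConst {n : ℕ} (t : Term (L.withConsts C) n) :
    ∃ F : Set C, F.Finite ∧ ∀ c ∉ F, ∀ (M : Structure (L.withConsts C)) (a : M.carrier)
      (v : Fin n → M.carrier),
      t.eval (M.setConst c a).toPrestructure v = t.eval M.toPrestructure v := by
  induction t with
  | var i => exact ⟨∅, Set.finite_empty, fun _ _ _ _ _ => rfl⟩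
  | func f ts ih =>
    choose F hF h using ih
    rcases f with f | c'
    · refine ⟨⋃ i, F i, Set.finite_iUnion hF, fun c hc M a v => ?_⟩
      have hc' : ∀ i, c ∉ F i := fun i hi => hc (Set.mem_iUnion.2 ⟨i, hi⟩)
      exact congrArg (M.func (Sum.inl f)) (funext fun i => h i c (hc' i) M a v)
    · refine ⟨{c'}, Set.finite_singleton c', fun c hc M a v => ?_⟩
      have hne : c' ≠ c := fun h => hc h.symm
      refine (if_neg hne).trans ?_
      exact congrArg (M.func (Sum.inr c')) (funext fun i : Fin 0 => i.elim0)

theorem Atomic.exists_finite_eval_setConst {n : ℕ} (b : Atomic (L.withConsts C) n) :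
    ∃ F : Set C, F.Finite ∧ ∀ c ∉ F, ∀ (M : Structure (L.withConsts C)) (a : M.carrier)
      (v : Fin n → M.carrier),
      b.eval (M.setConst c a).toPrestructure v = b.eval M.toPrestructure v := by
  cases b with
  | rel R ts =>
    choose F hF h using fun i => (ts i).exists_finite_eval_setConst
    refine ⟨⋃ i, F i, Set.finite_iUnion hF, fun c hc M a v => ?_⟩
    have hc' : ∀ i, c ∉ F i := fun i hi => hc (Set.mem_iUnion.2 ⟨i, hi⟩)
    exact congrArg (M.rel R) (funext fun i => h i c (hc' i) M a v)
  | dist t s =>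
    obtain ⟨F, hF, h⟩ := t.exists_finite_eval_setConst
    obtain ⟨F', hF', h'⟩ := s.exists_finite_eval_setConst
    refine ⟨F ∪ F', hF.union hF', fun c hc M a v => Subtype.ext ?_⟩
    exact congrArg₂ (fun x y : M.carrier => Dist.dist x y)
      (h c (fun hi => hc (Or.inl hi)) M a v) (h' c (fun hi => hc (Or.inr hi)) M a v)

theorem RFormula.IsQF.exists_finite_eval_setConst {n : ℕ} {φ : RFormula (L.withConsts C) n}
    (hφ : φ.IsQF) :
    ∃ F : Set C, F.Finite ∧ ∀ c ∉ F, ∀ (M : Structure (L.withConsts C)) (a : M.carrier)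
      (v : Fin n → M.carrier),
      φ.eval (M.setConst c a).toPrestructure v = φ.eval M.toPrestructure v := by
  induction φ with
  | atom b => exact b.exists_finite_eval_setConst
  | neg φ ih =>
    obtain ⟨F, hF, h⟩ := ih hφ
    exact ⟨F, hF, fun c hc M a v => congrArg σ (h c hc M a v)⟩
  | half φ ih =>
    obtain ⟨F, hF, h⟩ := ih hφ
    exact ⟨F, hF, fun c hc M a v => congrArg halfI (h c hc M a v)⟩
  | plus φ ψ ihφ ihψ =>
    obtain ⟨F, hF, h⟩ := ihφ hφ.1
    obtain ⟨F', hF', h'⟩ := ihψ hφ.2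
    exact ⟨F ∪ F', hF.union hF', fun c hc M a v => congrArg₂ plusI
      (h c (fun hi => hc (Or.inl hi)) M a v) (h' c (fun hi => hc (Or.inr hi)) M a v)⟩
  | bigvee φ ih => exact hφ.elim
  | inf φ ih => exact hφ.elim

end SetConst

/-! ### Requirements and generic sequences -/

section Generic

variable {L : Signature} {C : Type} {T : Set (Formula L 0)}

theorem Condition.exists_extension (p : Condition C T) {M : Structure (L.withConsts C)}
    (hM : Models T p.ineqs M) {F : Set (Ineq L C)} (hF : F.Finite) (hqf : ∀ e ∈ F, e.1.IsQF)
    (hFM : ∀ e ∈ F, (e.1.eval M.toPrestructure Fin.elim0 : ℝ) < e.2) :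
    ∃ q : Condition C T, p ≤ q ∧ F ⊆ q.ineqs :=
  ⟨{ ineqs := p.ineqs ∪ F
     finite := p.finite.union hF
     isQF := fun e he => he.elim (p.isQF e) (hqf e)
     satisfiable := ⟨M, hM.1, fun e he => he.elim (hM.2 e) (hFM e)⟩ },
    Set.subset_union_left, Set.subset_union_right⟩

theorem Models.mono {Γ Δ : Set (Ineq L C)} (h : Γ ⊆ Δ) {M : Structure (L.withConsts C)}
    (hM : Models T Δ M) : Models T Γ M :=
  ⟨hM.1, fun e he => hM.2 e (h he)⟩

/-- A requirement on consecutive elements of a sequence of conditions: it can be met from every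
condition, and remains met when the second condition is extended. -/
structure IsRequirement (R : Condition C T → Condition C T → Prop) : Prop where
  exists_ge : ∀ p, ∃ q, p ≤ q ∧ R p q
  mono : ∀ {p q q'}, R p q → q ≤ q' → R p q'

/-- The positive real `1 / (k + 1)`. -/
def tol (k : ℕ) : ℝ := 1 / ((k : ℝ) + 1)

theorem tol_pos (k : ℕ) : 0 < tol k := Nat.one_div_pos_of_nat

theorem exists_tol_lt {ε : ℝ} (hε : 0 < ε) : ∃ k, tol k < ε := exists_nat_one_div_lt hε

theorem le_of_forall_le_add_tol {x y : ℝ} (h : ∀ k, x ≤ y + tol k) : x ≤ y := by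
  refine le_of_forall_pos_le_add fun ε hε => ?_
  obtain ⟨k, hk⟩ := exists_tol_lt hε
  linarith [h k]

/-- Every inequality of `p` is improved in `q`. -/
def Tightens (p q : Condition C T) : Prop := ∀ e ∈ p.ineqs, ∃ r < e.2, (e.1, r) ∈ q.ineqs

/-- In models of `q`, the value of `a` is close to `atomValue q a`. -/
def DecidesAtom (a : Atomic (L.withConsts C) 0) (k : ℕ) (_ q : Condition C T) : Prop :=
  ∀ M, Models T q.ineqs M →
    (atomValue q a : ℝ) ≤ a.eval M.toPrestructure Fin.elim0 + tol k

/-- In models of `q`, the value of the closed term `t` is close to a constant. -/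
def NamesTerm (t : Term (L.withConsts C) 0) (k : ℕ) (_ q : Condition C T) : Prop :=
  ∃ c : C, ∀ M, Models T q.ineqs M →
    dist (t.eval M.toPrestructure Fin.elim0) ((constTerm L c).eval M.toPrestructure Fin.elim0)
      ≤ tol k

/-- The strong forcing value of `ψ(v)` at `q` is nearly optimal among the extensions of `p`. -/
def NearlyOptimal {n : ℕ} (ψ : RFormula (L.withConsts C) n) (v : Fin n → C) (k : ℕ)
    (p q : Condition C T) : Prop :=
  (strongValue ψ q v : ℝ) ≤
    (⨅ q' : {q' : Condition C T // p ≤ q'}, strongValue ψ q'.1 v : I) + tol k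

theorem atomValue_antitone (a : Atomic (L.withConsts C) 0) :
    Antitone fun p : Condition C T => atomValue p a :=
  fun _ _ hpq => sInf_le_sInf fun _ hr => hpq hr

theorem halfI_mono : Monotone halfI := fun x y h => by
  have h' : (x : ℝ) ≤ y := h
  exact Subtype.coe_le_coe.1 (by change (x : ℝ) / 2 ≤ y / 2; linarith)

theorem plusI_mono {x x' y y' : I} (h : x ≤ x') (h' : y ≤ y') : plusI x y ≤ plusI x' y' :=
  Subtype.coe_le_coe.1 (min_le_min_right _ (add_le_add h h'))

theorem strongValue_antitone {n : ℕ} (φ : RFormula (L.withConsts C) n) (v : Fin n → C) :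
    Antitone fun p : Condition C T => strongValue φ p v := by
  induction φ with
  | atom a => exact atomValue_antitone _
  | neg φ ih =>
    intro p q hpq
    exact unitInterval.symm_le_symm.2 (le_iInf fun r =>
      iInf_le (fun r : {r : Condition C T // p ≤ r} => strongValue φ r.1 v)
        ⟨r.1, hpq.trans r.2⟩)
  | half φ ih => exact fun p q hpq => halfI_mono (ih v hpq)
  | plus φ ψ ihφ ihψ => exact fun p q hpq => plusI_mono (ihφ v hpq) (ihψ v hpq)
  | bigvee φ ih => exact fun p q hpq => iInf_mono fun m => ih m v hpq
  | inf φ ih => exact fun p q hpq => iInf_mono fun c => ih _ hpq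

theorem isRequirement_tightens : IsRequirement (Tightens : Condition C T → _) where
  exists_ge p := by
    obtain ⟨M, hM⟩ := p.satisfiable
    obtain ⟨q, hpq, hq⟩ := p.exists_extension hM
      (F := (fun e : Ineq L C =>
        (e.1, ((e.1.eval M.toPrestructure Fin.elim0 : ℝ) + e.2) / 2)) '' p.ineqs)
      (p.finite.image _) (by rintro _ ⟨e, he, rfl⟩; exact p.isQF e he)
      (by rintro _ ⟨e, he, rfl⟩; dsimp only; linarith [hM.2 e he])
    exact ⟨q, hpq, fun e he => ⟨_, by linarith [hM.2 e he], hq ⟨e, he, rfl⟩⟩⟩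
  mono h hq e he := (h e he).imp fun _ hr => ⟨hr.1, hq hr.2⟩

theorem isRequirement_decidesAtom (a : Atomic (L.withConsts C) 0) (k : ℕ) :
    IsRequirement (DecidesAtom a k : Condition C T → _) where
  exists_ge p := by
    obtain ⟨M, hM⟩ := p.satisfiable
    set x : I := a.eval M.toPrestructure Fin.elim0 with hx
    have hk := tol_pos k
    have hlow : ∀ {q : Condition C T}, (RFormula.neg (.atom a), 1 - (x : ℝ) + tol k / 2) ∈ q.ineqs →
        ∀ N, Models T q.ineqs N → (x : ℝ) ≤ a.eval N.toPrestructure Fin.elim0 + tol k / 2 := by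
      intro q hq N hN
      have h1 : 1 - (a.eval N.toPrestructure Fin.elim0 : ℝ) < 1 - (x : ℝ) + tol k / 2 := hN.2 _ hq
      linarith
    have hMneg : ((RFormula.neg (.atom a)).eval M.toPrestructure Fin.elim0 : ℝ) <
        1 - (x : ℝ) + tol k / 2 := by
      change 1 - (x : ℝ) < _
      linarith
    by_cases hx1 : x = 1
    · obtain ⟨q, hpq, hq⟩ := p.exists_extension hM
        (F := {(RFormula.neg (.atom a), 1 - (x : ℝ) + tol k / 2)}) (Set.finite_singleton _)
        (by rintro _ rfl; trivial) (by rintro _ rfl; exact hMneg)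
      refine ⟨q, hpq, fun N hN => ?_⟩
      have h1 := hlow (hq rfl) N hN
      have h2 := (atomValue q a).2.2
      have h3 : (x : ℝ) = 1 := by rw [hx1]; rfl
      linarith
    · have hxlt : (x : ℝ) < 1 := lt_of_le_of_ne x.2.2 fun h => hx1 (Subtype.ext h)
      let r : I := ⟨min ((x : ℝ) + tol k / 2) 1,
        le_min (by linarith [x.2.1]) zero_le_one, min_le_right _ _⟩
      obtain ⟨q, hpq, hq⟩ := p.exists_extension hM
        (F := {(RFormula.neg (.atom a), 1 - (x : ℝ) + tol k / 2), (.atom a, (r : ℝ))})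
        (Set.toFinite _) (by rintro _ (rfl | rfl) <;> trivial)
        (by
          rintro _ (rfl | rfl)
          · exact hMneg
          · change (x : ℝ) < min ((x : ℝ) + tol k / 2) 1
            exact lt_min (by linarith) hxlt)
      refine ⟨q, hpq, fun N hN => ?_⟩
      have h1 := hlow (hq (Or.inl rfl)) N hN
      have h2 : (atomValue q a : ℝ) ≤ r := Subtype.coe_le_coe.2 (sInf_le (hq (Or.inr rfl)))
      have h3 : (r : ℝ) ≤ (x : ℝ) + tol k / 2 := min_le_left _ _
      linarith
  mono h hq M hM :=
    (Subtype.coe_le_coe.2 (atomValue_antitone a hq)).trans (h M (hM.mono hq))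

theorem isRequirement_namesTerm [Infinite C] (t : Term (L.withConsts C) 0) (k : ℕ) :
    IsRequirement (NamesTerm t k : Condition C T → _) where
  exists_ge p := by
    obtain ⟨M, hM⟩ := p.satisfiable
    obtain ⟨F, hF, ht⟩ := t.exists_finite_eval_setConst
    choose! G hG hGe using fun e (he : e ∈ p.ineqs) => (p.isQF e he).exists_finite_eval_setConst
    obtain ⟨c, hc⟩ := (hF.union (p.finite.biUnion hG)).exists_notMem
    have hcF : c ∉ F := fun h => hc (Or.inl h)
    have hcG : ∀ e ∈ p.ineqs, c ∉ G e := fun e he h => hc (Or.inr (Set.mem_biUnion he h))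
    set N := M.setConst c (t.eval M.toPrestructure Fin.elim0) with hN
    have hNp : Models T p.ineqs N :=
      ⟨hM.1, fun e he => (congrArg Subtype.val (hGe e he c (hcG e he) M _ _)).trans_lt (hM.2 e he)⟩
    obtain ⟨q, hpq, hq⟩ := p.exists_extension hNp
      (F := {(.atom (.dist t (constTerm L c)), tol k)}) (Set.finite_singleton _)
      (by rintro _ rfl; trivial)
      (by
        rintro _ rfl
        change dist (t.eval N.toPrestructure Fin.elim0)
          ((constTerm L c).eval N.toPrestructure Fin.elim0) < tol k
        have h1 : t.eval N.toPrestructure Fin.elim0 =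
            (constTerm L c).eval N.toPrestructure Fin.elim0 :=
          (ht c hcF M _ _).trans (M.eval_constTerm_setConst c _ _).symm
        rw [h1, dist_self]
        exact tol_pos k)
    exact ⟨q, hpq, c, fun K hK => (hK.2 _ (hq rfl)).le⟩
  mono := fun ⟨c, hc⟩ hq => ⟨c, fun M hM => hc M (hM.mono hq)⟩

theorem isRequirement_nearlyOptimal {n : ℕ} (ψ : RFormula (L.withConsts C) n) (v : Fin n → C)
    (k : ℕ) : IsRequirement (NearlyOptimal ψ v k : Condition C T → _) where
  exists_ge p := by
    have : Nonempty {q : Condition C T // p ≤ q} := ⟨⟨p, le_rfl⟩⟩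
    obtain ⟨q, hq⟩ := exists_lt_iInf_add
      (fun q : {q : Condition C T // p ≤ q} => strongValue ψ q.1 v) (tol_pos k)
    exact ⟨q.1, q.2, hq.le⟩
  mono h hq := (Subtype.coe_le_coe.2 (strongValue_antitone ψ v hq)).trans h

/-- The requirements that make a sequence of conditions generic for a set of formulas. -/
def requirements (T : Set (Formula L 0)) (X : Set (Σ n, RFormula (L.withConsts C) n)) :
    Set (Condition C T → Condition C T → Prop) :=
  {Tightens} ∪ Set.range (fun x : Atomic (L.withConsts C) 0 × ℕ => DecidesAtom x.1 x.2) ∪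
    Set.range (fun x : Term (L.withConsts C) 0 × ℕ => NamesTerm x.1 x.2) ∪
    Set.range (fun x : (Σ ψ : X, Fin ψ.1.1 → C) × ℕ => NearlyOptimal x.1.1.1.2 x.1.2 x.2)

instance [Countable L.Func] [Countable C] : Countable (L.withConsts C).Func :=
  inferInstanceAs (Countable (L.Func ⊕ C))

instance [Countable L.Rel] : Countable (L.withConsts C).Rel :=
  inferInstanceAs (Countable L.Rel)

theorem countable_requirements [Countable L.Func] [Countable L.Rel] [Countable C]
    {X : Set (Σ n, RFormula (L.withConsts C) n)} (hX : X.Countable) :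
    (requirements T X).Countable := by
  have := hX.to_subtype
  exact (((Set.countable_singleton _).union (Set.countable_range _)).union
    (Set.countable_range _)).union (Set.countable_range _)

theorem isRequirement_of_mem [Infinite C] {X : Set (Σ n, RFormula (L.withConsts C) n)}
    {R : Condition C T → Condition C T → Prop} (hR : R ∈ requirements T X) : IsRequirement R := by
  rcases hR with ((rfl | ⟨x, rfl⟩) | ⟨x, rfl⟩) | ⟨x, rfl⟩
  · exact isRequirement_tightens
  · exact isRequirement_decidesAtom _ _
  · exact isRequirement_namesTerm _ _
  · exact isRequirement_nearlyOptimal _ _ _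

/-- The requirements can be listed so that each of them occurs infinitely often. -/
theorem exists_enumeration [Countable L.Func] [Countable L.Rel] [Countable C] [Infinite C]
    {X : Set (Σ n, RFormula (L.withConsts C) n)} (hX : X.Countable) :
    ∃ R : ℕ → Condition C T → Condition C T → Prop, (∀ m, IsRequirement (R m)) ∧
      ∀ Q ∈ requirements T X, ∀ N, ∃ m ≥ N, R m = Q := by
  obtain ⟨f, hf⟩ := (countable_requirements (T := T) hX).exists_eq_range
    ⟨Tightens, Or.inl (Or.inl (Or.inl rfl))⟩
  refine ⟨fun m => f m.unpair.1, fun m => isRequirement_of_mem (X := X) (hf ▸ ⟨_, rfl⟩),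
    fun Q hQ N => ?_⟩
  obtain ⟨j, rfl⟩ := hf ▸ hQ
  exact ⟨Nat.pair j N, Nat.right_le_pair j N, by simp⟩

/-- A sequence of conditions that meets every requirement for `X` infinitely often. -/
structure IsGeneric (X : Set (Σ n, RFormula (L.withConsts C) n)) (s : ℕ → Condition C T) :
    Prop where
  monotone : Monotone s
  meets : ∀ R ∈ requirements T X, ∀ N, ∃ n ≥ N, R (s n) (s (n + 1))

namespace IsGeneric

variable {X : Set (Σ n, RFormula (L.withConsts C) n)} {s : ℕ → Condition C T}

theorem exists_models [Nonempty C] (hs : IsGeneric X s) :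
    ∃ M : Structure (L.withConsts C), Models T (⋃ n, (s n).ineqs) M := by
  refine exists_models_iUnion hs.monotone fun n e he => ?_
  obtain ⟨m, hm, h⟩ := hs.meets _ (Or.inl (Or.inl (Or.inl rfl))) n
  obtain ⟨r, hr, hr'⟩ := h e (hs.monotone hm he)
  exact ⟨r, hr, m + 1, hr'⟩

theorem atomic_eval_eq (hs : IsGeneric X s) (a : Atomic (L.withConsts C) 0)
    {M : Structure (L.withConsts C)} (hM : Models T (⋃ n, (s n).ineqs) M) :
    a.eval M.toPrestructure Fin.elim0 = ⨅ n, atomValue (s n) a := by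
  refine le_antisymm (le_iInf fun n => le_sInf fun r hr => ?_) ?_
  · exact (Subtype.coe_lt_coe.1 (hM.2 _ (Set.mem_iUnion.2 ⟨n, hr⟩))).le
  · refine Subtype.coe_le_coe.1 (le_of_forall_le_add_tol fun k => ?_)
    obtain ⟨n, -, h⟩ := hs.meets _ (Or.inl (Or.inl (Or.inr ⟨(a, k), rfl⟩))) 0
    refine le_trans ?_ (h M (hM.mono (Set.subset_iUnion (fun n => (s n).ineqs) (n + 1))))
    exact Subtype.coe_le_coe.2 (iInf_le (fun n => atomValue (s n) a) (n + 1))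

theorem definitive [Nonempty C] (hs : IsGeneric X s) : Definitive T (⋃ n, (s n).ineqs) := by
  intro a
  obtain ⟨M, hM⟩ := hs.exists_models
  exact ⟨_, fun N hN => hs.atomic_eval_eq a hN, fun r hr =>
    (hr M hM).symm.trans (hs.atomic_eval_eq a hM)⟩

theorem value_eq [Nonempty C] (hs : IsGeneric X s) (h : Definitive T (⋃ n, (s n).ineqs))
    (a : Atomic (L.withConsts C) 0) : h.value a = ⨅ n, atomValue (s n) a := by
  obtain ⟨M, hM⟩ := hs.exists_models
  rw [h.value_eq a hM, hs.atomic_eval_eq a hM]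

end IsGeneric

/-! ### Truth in the compiled structure of a generic sequence -/

namespace Definitive

variable {Γ : Set (Ineq L C)} (h : Definitive T Γ)

/-- The constant `c` in the compiled structure. -/
def constPoint (c : C) : h.compiled.carrier :=
  UniformSpace.Completion.coe' (α := h.termPrestructure.carrier) (constTerm L c)

/-- The tuple of constants `v` in the compiled structure. -/
def constTuple {n : ℕ} (v : Fin n → C) : Fin n → h.compiled.carrier :=
  fun i => h.constPoint (v i)

theorem eval_term {n : ℕ} (t : Term (L.withConsts C) n) (v : Fin n → C) :
    t.eval h.termPrestructure (fun i => constTerm L (v i)) = t.subst v := by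
  induction t with
  | var i => rfl
  | func f ts ih => exact congrArg (Term.func f) (funext ih)

theorem eval_atomic {n : ℕ} (a : Atomic (L.withConsts C) n) (v : Fin n → C) :
    a.eval h.compiled.toPrestructure (h.constTuple v) = h.value (a.subst v) := by
  refine (a.eval_completion h.termPrestructure fun i => constTerm L (v i)).trans ?_
  cases a with
  | rel R ts =>
    exact congrArg (fun us => h.value (.rel (S := L.withConsts C) R us))
      (funext fun i => h.eval_term (ts i) v)
  | dist t s =>
    apply Subtype.ext
    exact congrArg₂ (fun t s => (h.value (.dist t s) : ℝ)) (h.eval_term t v) (h.eval_term s v)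

theorem constTuple_snoc {n : ℕ} (v : Fin n → C) (c : C) :
    h.constTuple (Fin.snoc v c) = Fin.snoc (h.constTuple v) (h.constPoint c) :=
  Fin.comp_snoc h.constPoint v c

end Definitive

namespace IsGeneric

variable {X : Set (Σ n, RFormula (L.withConsts C) n)} {s : ℕ → Condition C T}

theorem denseRange_const [Nonempty C] (hs : IsGeneric X s)
    (h : Definitive T (⋃ n, (s n).ineqs)) :
    DenseRange h.constPoint := by
  refine Metric.denseRange_iff.2 fun x ε hε => ?_
  obtain ⟨t, ht⟩ := Metric.denseRange_iff.1
    (UniformSpace.Completion.denseRange_coe (α := h.termPrestructure.carrier)) x (ε / 2)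
    (half_pos hε)
  obtain ⟨k, hk⟩ := exists_tol_lt (half_pos hε)
  obtain ⟨n, -, c, hc⟩ := hs.meets _ (Or.inl (Or.inr ⟨(t, k), rfl⟩)) 0
  obtain ⟨M, hM⟩ := hs.exists_models
  refine ⟨c, (dist_triangle _ _ _).trans_lt ((add_lt_add_of_lt_of_le ht ?_).trans_eq
    (add_halves ε))⟩
  refine (UniformSpace.Completion.dist_eq (α := h.termPrestructure.carrier) _ _).trans_le
    (le_trans ?_ hk.le)
  exact (h.value_dist hM t (constTerm L c)).trans_le
    (hc M (hM.mono (Set.subset_iUnion (fun n => (s n).ineqs) (n + 1))))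

theorem iInf_strongValue_neg (hs : IsGeneric X s) {n : ℕ} {ψ : RFormula (L.withConsts C) n}
    (hψ : ⟨n, ψ⟩ ∈ X) (v : Fin n → C) :
    σ (⨅ k, strongValue ψ (s k) v) = ⨅ k, strongValue (.neg ψ) (s k) v := by
  refine le_antisymm (le_iInf fun m => unitInterval.symm_le_symm.2 (le_iInf fun k => ?_)) ?_
  · refine (iInf_le (fun q : {q : Condition C T // s m ≤ q} => strongValue ψ q.1 v)
      ⟨s (max m k), hs.monotone (le_max_left m k)⟩).trans ?_
    exact strongValue_antitone ψ v (hs.monotone (le_max_right m k))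
  · refine Subtype.coe_le_coe.1 (le_of_forall_le_add_tol fun j => ?_)
    obtain ⟨m, -, h⟩ := hs.meets _ (Or.inr ⟨(⟨⟨_, hψ⟩, v⟩, j), rfl⟩) 0
    have h1 : ((⨅ k, strongValue (.neg ψ) (s k) v : I) : ℝ) ≤ strongValue (.neg ψ) (s m) v :=
      Subtype.coe_le_coe.2 (iInf_le (fun k => strongValue (.neg ψ) (s k) v) m)
    have h2 : ((⨅ k, strongValue ψ (s k) v : I) : ℝ) ≤ strongValue ψ (s (m + 1)) v :=
      Subtype.coe_le_coe.2 (iInf_le (fun k => strongValue ψ (s k) v) (m + 1))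
    have h3 : (strongValue (.neg ψ) (s m) v : ℝ) =
        1 - (⨅ q' : {q' : Condition C T // s m ≤ q'}, strongValue ψ q'.1 v : I) := rfl
    have h4 : (strongValue ψ (s (m + 1)) v : ℝ) ≤
      (⨅ q' : {q' : Condition C T // s m ≤ q'}, strongValue ψ q'.1 v : I) + tol j := h
    rw [unitInterval.coe_symm_eq]
    linarith

theorem tendsto_strongValue (hs : IsGeneric X s) {n : ℕ} (ψ : RFormula (L.withConsts C) n)
    (v : Fin n → C) :
    Tendsto (fun k => strongValue ψ (s k) v) atTop (𝓝 (⨅ k, strongValue ψ (s k) v)) :=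
  tendsto_atTop_iInf fun _ _ hkm => strongValue_antitone ψ v (hs.monotone hkm)

/-- The value of a formula in the compiled structure of a generic sequence is the limit of its
strong forcing values. -/
theorem eval_compiled [Nonempty C] (hs : IsGeneric X s) (h : Definitive T (⋃ n, (s n).ineqs))
    {n : ℕ} {ψ : RFormula (L.withConsts C) n} (hψ : ψ.WF) (hX : ψ.negated ⊆ X) (v : Fin n → C) :
    ψ.eval h.compiled.toPrestructure (h.constTuple v) = ⨅ k, strongValue ψ (s k) v := by
  induction ψ with
  | atom a => exact (h.eval_atomic a v).trans (hs.value_eq h _)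
  | neg ψ ih =>
    exact (congrArg σ (ih hψ ((Set.subset_insert _ _).trans hX) v)).trans
      (hs.iInf_strongValue_neg (hX (Set.mem_insert _ _)) v)
  | half ψ ih =>
    exact (congrArg halfI (ih hψ hX v)).trans (tendsto_nhds_unique
      ((continuous_halfI.tendsto _).comp (hs.tendsto_strongValue ψ v))
      (hs.tendsto_strongValue (.half ψ) v))
  | plus ψ χ ihψ ihχ =>
    exact (congrArg₂ plusI (ihψ hψ.1 (Set.subset_union_left.trans hX) v)
      (ihχ hψ.2 (Set.subset_union_right.trans hX) v)).trans (tendsto_nhds_unique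
      ((continuous_plusI.tendsto (_, _)).comp
        ((hs.tendsto_strongValue ψ v).prodMk_nhds (hs.tendsto_strongValue χ v)))
      (hs.tendsto_strongValue (.plus ψ χ) v))
  | bigvee ψ ih =>
    exact (iInf_congr fun m =>
      ih m (hψ.1 m) ((Set.subset_iUnion (fun m => (ψ m).negated) m).trans hX) v).trans iInf_comm
  | inf ψ ih =>
    refine ((hs.denseRange_const h).iInf_comp_eq
      ((RFormula.WF.uniformContinuous_eval (φ := ψ) h.compiled hψ).continuous.comp
        (continuous_snoc (h.constTuple v)))).trans (Eq.trans (iInf_congr fun c => ?_) iInf_comm)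
    exact (congrArg (ψ.eval h.compiled.toPrestructure) (h.constTuple_snoc v c).symm).trans
      (ih hψ hX _)

theorem eval_compiled_sentence [Nonempty C] (hs : IsGeneric X s)
    (h : Definitive T (⋃ n, (s n).ineqs)) {φ : RFormula (L.withConsts C) 0} (hφ : φ.WF)
    (hX : φ.negated ⊆ X) :
    φ.eval h.compiled.toPrestructure Fin.elim0 = ⨅ k, strongValue φ (s k) Fin.elim0 :=
  (congrArg (φ.eval h.compiled.toPrestructure) (funext fun j => j.elim0)).trans
    (hs.eval_compiled h hφ hX Fin.elim0)

end IsGeneric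

end Generic

/-! ### The game -/

section Game

/-- The sequence that starts with `a` and in which each later element is determined by the
preceding ones. -/
def recSeq {α : Type*} (a : α) (next : (n : ℕ) → (Fin (n + 1) → α) → α) : ℕ → α
  | 0 => a
  | n + 1 => next n fun i : Fin (n + 1) => recSeq a next i
decreasing_by exact i.2

variable {L : Signature} {C : Type} {T : Set (Formula L 0)}

theorem strongValue_lt_of_weakValue_lt {p : Condition C T} {φ : RFormula (L.withConsts C) 0}
    {r : ℝ} (h : (weakValue p φ : ℝ) < r) {q : Condition C T} (hpq : p ≤ q) :
    ∃ q', q ≤ q' ∧ (strongValue φ q' Fin.elim0 : ℝ) < r := by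
  have : Nonempty {q' : Condition C T // q ≤ q'} := ⟨⟨q, le_rfl⟩⟩
  obtain ⟨q', hq'⟩ := exists_lt_iInf_add
    (fun q' : {q' : Condition C T // q ≤ q'} => strongValue φ q'.1 Fin.elim0) (sub_pos.2 h)
  have h1 : ((⨅ q' : {q' : Condition C T // q ≤ q'}, strongValue φ q'.1 Fin.elim0 : I) : ℝ) ≤
      weakValue p φ :=
    Subtype.coe_le_coe.2 (le_iSup (fun q : {q : Condition C T // p ≤ q} =>
      ⨅ q' : {q' : Condition C T // q.1 ≤ q'}, strongValue φ q'.1 Fin.elim0) ⟨q, hpq⟩)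
  exact ⟨q'.1, q'.2, by linarith⟩

variable [Countable L.Func] [Countable L.Rel] [Countable C] [Infinite C]

/-- Player `∃` can enforce `φ < r` if `r` exceeds the weak forcing value, by playing generically
and making the strong forcing value less than `r`. -/
theorem forces_of_weakValue_lt {p : Condition C T} {φ : RFormula (L.withConsts C) 0}
    (hφ : φ.WF) {r : ℝ} (h : (weakValue p φ : ℝ) < r) :
    Forces p fun A => (φ.eval A.toPrestructure Fin.elim0 : ℝ) < r := by
  intro k pos _ hp
  obtain ⟨R, hR, henum⟩ := exists_enumeration (T := T) φ.countable_negated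
  have step : ∀ m (q : Condition C T), ∃ q', q ≤ q' ∧ R m q q' ∧
      (p ≤ q → (strongValue φ q' Fin.elim0 : ℝ) < r) := by
    intro m q
    obtain ⟨q₁, hq₁, hRq₁⟩ := (hR m).exists_ge q
    by_cases hpq : p ≤ q
    · obtain ⟨q₂, hq₂, hlt⟩ := strongValue_lt_of_weakValue_lt h (hpq.trans hq₁)
      exact ⟨q₂, hq₁.trans hq₂, (hR m).mono hRq₁ hq₂, fun _ => hlt⟩
    · exact ⟨q₁, hq₁, hRq₁, fun h => absurd h hpq⟩
  choose g hg hgR hgr using step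
  refine ⟨⟨fun n hist => g (n / 2) (hist (Fin.last n)), fun n hist => hg _ _⟩,
    fun s hs hpos hplay => ?_⟩
  have hmove : ∀ m, k ≤ 2 * m → s (2 * m + 1) = g m (s (2 * m)) := by
    intro m hm
    have h1 := hplay (2 * m) hm (odd_two_mul_add_one m)
    simpa using h1
  have hgen : IsGeneric φ.negated s := by
    refine ⟨hs, fun Q hQ N => ?_⟩
    obtain ⟨m, hm, rfl⟩ := henum Q hQ (max N k)
    refine ⟨2 * m, by have := le_max_left N k; omega, ?_⟩
    rw [hmove m (by have := le_max_right N k; omega)]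
    exact hgR _ _
  refine ⟨hgen.definitive, ?_⟩
  beta_reduce
  rw [hgen.eval_compiled_sentence _ hφ le_rfl]
  have hpk : p ≤ s (2 * k) := by
    refine (hp.trans_eq (hpos (Fin.last k)).symm).trans (hs ?_)
    simp only [Fin.val_last]
    omega
  have h1 := hgr k (s (2 * k)) hpk
  rw [← hmove k (by omega)] at h1
  exact lt_of_le_of_lt
    (Subtype.coe_le_coe.2 (iInf_le (fun n => strongValue φ (s n) Fin.elim0) (2 * k + 1))) h1

/-- If `p` forces `φ < r`, then the weak forcing value is at most `r`: player `∀` plays generically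
against a winning strategy of player `∃`. -/
theorem weakValue_le_of_forces {p : Condition C T} {φ : RFormula (L.withConsts C) 0}
    (hφ : φ.WF) {r : ℝ}
    (h : Forces p fun A => (φ.eval A.toPrestructure Fin.elim0 : ℝ) < r) :
    (weakValue p φ : ℝ) ≤ r := by
  have key : ∀ q : Condition C T, p ≤ q →
      ((⨅ q' : {q' : Condition C T // q ≤ q'}, strongValue φ q'.1 Fin.elim0 : I) : ℝ) < r := by
    intro q hpq
    obtain ⟨τ, hτ⟩ := h 0 (fun _ => q) monotone_const hpq
    obtain ⟨R, hR, henum⟩ := exists_enumeration (T := T) φ.countable_negated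
    choose g hg hgR using fun m => (hR m).exists_ge
    let next : (n : ℕ) → (Fin (n + 1) → Condition C T) → Condition C T := fun n hist =>
      if Odd (n + 1) then τ.move n hist else g (n / 2) (hist (Fin.last n))
    let s : ℕ → Condition C T := recSeq q next
    have hs0 : s 0 = q := by simp only [s, recSeq]
    have hsucc : ∀ n, s (n + 1) = next n fun i : Fin (n + 1) => s i := fun n => by
      simp only [s]
      rw [recSeq]
    have hodd : ∀ n, Odd (n + 1) → s (n + 1) = τ.move n fun i : Fin (n + 1) => s i :=
      fun n hn => (hsucc n).trans (if_pos hn)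
    have heven : ∀ n, ¬ Odd (n + 1) → s (n + 1) = g (n / 2) (s n) :=
      fun n hn => (hsucc n).trans (if_neg hn)
    have hmono : Monotone s := by
      refine monotone_nat_of_le_succ fun n => ?_
      by_cases hn : Odd (n + 1)
      · rw [hodd n hn]
        exact τ.legal n fun i : Fin (n + 1) => s i
      · rw [heven n hn]
        exact hg _ _
    have hgen : IsGeneric φ.negated s := by
      refine ⟨hmono, fun Q hQ N => ?_⟩
      obtain ⟨m, hm, rfl⟩ := henum Q hQ N
      refine ⟨2 * m + 1, by omega, ?_⟩
      rw [heven (2 * m + 1) (by rw [Nat.not_odd_iff_even]; exact ⟨m + 1, by ring⟩)]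
      have h1 : (2 * m + 1) / 2 = m := by omega
      rw [h1]
      exact hgR _ _
    obtain ⟨hdef, hlt⟩ := hτ s hmono
      (fun i => by rw [Fin.fin_one_eq_zero i]; exact hs0) fun n _ hn => hodd n hn
    rw [hgen.eval_compiled_sentence hdef hφ le_rfl] at hlt
    obtain ⟨n, hn⟩ := exists_lt_iInf_add (fun n => strongValue φ (s n) Fin.elim0)
      (sub_pos.2 hlt)
    have hqn : q ≤ s n := hs0.symm.trans_le (hmono (Nat.zero_le n))
    have h1 : ((⨅ q' : {q' : Condition C T // q ≤ q'}, strongValue φ q'.1 Fin.elim0 : I) : ℝ) ≤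
        strongValue φ (s n) Fin.elim0 :=
      Subtype.coe_le_coe.2 (iInf_le
        (fun q' : {q' : Condition C T // q ≤ q'} => strongValue φ q'.1 Fin.elim0) ⟨s n, hqn⟩)
    linarith
  have : Nonempty {q : Condition C T // p ≤ q} := ⟨⟨p, le_rfl⟩⟩
  refine le_of_forall_pos_le_add fun ε hε => ?_
  obtain ⟨q, hq⟩ := exists_iSup_sub_lt (fun q : {q : Condition C T // p ≤ q} =>
    ⨅ q' : {q' : Condition C T // q.1 ≤ q'}, strongValue φ q'.1 Fin.elim0) hε
  have h1 := key q.1 q.2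
  have h2 : (weakValue p φ : ℝ) - ε < _ := hq
  linarith

end Game

end ContGame

end

theorem mainTheorem10 (L : ContGame.Signature) [Countable L.Func] [Countable L.Rel]
    (C : Type) [Countable C] [Infinite C] (T : Set (ContGame.Formula L 0))
    (p : ContGame.Condition C T) (φ : ContGame.RFormula (L.withConsts C) 0) (hφ : φ.WF) :
    ContGame.gameValue p φ = (ContGame.weakValue p φ : ℝ) := by
  have hmem : ∀ r, (ContGame.weakValue p φ : ℝ) < r → r ∈ {r : ℝ | 0 < r ∧
      ContGame.Forces p fun A => (φ.eval A.toPrestructure Fin.elim0 : ℝ) < r} := fun r hr =>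
    ⟨(ContGame.weakValue p φ).2.1.trans_lt hr, ContGame.forces_of_weakValue_lt hφ hr⟩
  refine le_antisymm (le_of_forall_gt_imp_ge_of_dense fun r hr => ?_) ?_
  · exact csInf_le ⟨0, fun x hx => hx.1.le⟩ (hmem r hr)
  · exact le_csInf ⟨_, hmem _ (lt_add_one _)⟩ fun r hr => ContGame.weakValue_le_of_forces hφ hr.2
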